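/- Consider $T$ binary classification tasks in $\mathbb{R}^D$. Task $m\in\{1,\dots,T\}$ is a non-empty finite dataset $S_m$ of pairs $(x,y)\in\mathbb{R}^D\times\{-1,+1\}$, with feasible set $\mathcal{W}_m=\{w\in\mathbb{R}^D : y\,w^\top x\ge 1\ \ \forall (x,y)\in S_m\}$. The datasets are called separable if $\mathcal{W}_m\neq\emptyset$ for every $m$ (joint separability is not required). For almost all samples $x$ (that is, almost surely under any distribution of all the samples that is absolutely continuous with respect to Lebesgue measure, e.g. outside a Lebesgue-null set), the following holds for all labels that make the datasets separable, for every number of iterations $k$, every choice of the task $\tau(t)\in\{1,\dots,T\}$ learned in iteration $t\in\{1,\dots,k\}$, and all functions $\lambda_1,\dots,\lambda_k:\mathbb{R}_{>0}\to\mathbb{R}_{>0}$ such that $\lim_{\lambda\to0^+}\lambda_t(\lambda)=0$ for $1\le t\le k$ and the finite limit $c_t=\lim_{\lambda\to0^+}\frac{\ln\lambda_{t-1}(\lambda)}{\ln\lambda_t(\lambda)}$ exists for $2\le t\le k$. For $\lambda>0$ let $w_0^{(\lambda)}=0$ and $$w_t^{(\lambda)}=\operatorname*{argmin}_{w\in\mathbb{R}^D}\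 \sum_{(x,y)\in S_{\tau(t)}}e^{-y\,w^\top x}+\frac{\lambda_t(\lambda)}{2}\bigl\|w-w_{t-1}^{(\lambda)}\bigr\|^2,\qquad 1\le t\le k,$$ and let $w_0=0$ and $w_t=P_t(c_t\,w_{t-1})$ for $1\le t\le k$, where $P_t(v)=\operatorname*{argmin}_{w\in\mathcal{W}_{\tau(t)}}\|w-v\|^2$ is the Euclidean projection onto $\mathcal{W}_{\tau(t)}$ (the value of $c_1$ is irrelevant since $w_0=0$). Then, for every $t\in\{1,\dots,k\}$, $w_t\neq 0$ and $$\lim_{\lambda\to0^+}\frac{w_t^{(\lambda)}}{\|w_t^{(\lambda)}\|}=\frac{w_t}{\|w_t\|}.$$ -/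

import Mathlib

open Filter Topology MeasureTheory

/-- `ℝ^D` with the Euclidean norm. -/
abbrev Vec (D : ℕ) : Type := EuclideanSpace ℝ (Fin D)

/-- `w` minimizes `f` over the set `C`. -/
def IsArgmin {D : ℕ} (f : Vec D → ℝ) (C : Set (Vec D)) (w : Vec D) : Prop :=
  w ∈ C ∧ IsMinOn f C w

/-- The minimizer of `f` over `C` (an arbitrary vector if there is none). In both uses below it
exists and is unique: see `argmin_regObjective` and `maxMarginProj_spec`. -/
noncomputable def argminOn {D : ℕ} (f : Vec D → ℝ) (C : Set (Vec D)) : Vec D :=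
  Classical.epsilon (IsArgmin f C)

/-- The feasible set `{w | y wᵀx ≥ 1 for all (x, y) in the task}` of a task with samples `x i` and
labels `y i`. -/
def feasibleSet {D N : ℕ} (x : Fin N → Vec D) (y : Fin N → ℝ) : Set (Vec D) :=
  {w | ∀ i, 1 ≤ y i * inner ℝ w (x i)}

/-- The objective of one regularized learning step: the exponential loss of the task plus
`(l / 2) ‖w - v‖²`, where `l` is the regularization strength and `v` the previous solution. -/
noncomputable def regObjective {D N : ℕ} (x : Fin N → Vec D) (y : Fin N → ℝ) (l : ℝ)
    (v w : Vec D) : ℝ :=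
  ∑ i, Real.exp (-(y i * inner ℝ w (x i))) + l / 2 * ‖w - v‖ ^ 2

/-- The projection of `v` onto the feasible set of a task. -/
noncomputable def maxMarginProj {D N : ℕ} (x : Fin N → Vec D) (y : Fin N → ℝ) (v : Vec D) :
    Vec D :=
  argminOn (fun w => ‖w - v‖ ^ 2) (feasibleSet x y)

/-- The iterates of regularized continual learning. There are `T` tasks, task `m` having the
samples `x m i` and labels `y m i`; task `τ t` is learned in iteration `t`, with regularization
strength `l t`. -/
noncomputable def regIterate {D T : ℕ} {n : Fin T → ℕ} (x : (m : Fin T) → Fin (n m) → Vec D)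
    (y : (m : Fin T) → Fin (n m) → ℝ) (τ : ℕ → Fin T) (l : ℕ → ℝ) : ℕ → Vec D
  | 0 => 0
  | t + 1 => argminOn
      (regObjective (x (τ (t + 1))) (y (τ (t + 1))) (l (t + 1)) (regIterate x y τ l t)) Set.univ

/-- The iterates `w_t = P_t (c_t w_{t-1})`, `w_0 = 0`, of the scheduled Sequential Max-Margin
scheme. -/
noncomputable def smmIterate {D T : ℕ} {n : Fin T → ℕ} (x : (m : Fin T) → Fin (n m) → Vec D)
    (y : (m : Fin T) → Fin (n m) → ℝ) (τ : ℕ → Fin T) (c : ℕ → ℝ) : ℕ → Vec D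
  | 0 => 0
  | t + 1 => maxMarginProj (x (τ (t + 1))) (y (τ (t + 1))) (c (t + 1) • smmIterate x y τ c t)

/-! Well-posedness of the two schemes. -/

theorem sq_norm_midpoint {D : ℕ} (a b v : Vec D) :
    ‖midpoint ℝ a b - v‖ ^ 2 = ‖a - v‖ ^ 2 / 2 + ‖b - v‖ ^ 2 / 2 - ‖a - b‖ ^ 2 / 4 := by
  have h := parallelogram_law_with_norm ℝ (a - v) (b - v)
  have e1 : midpoint ℝ a b - v = (1 / 2 : ℝ) • ((a - v) + (b - v)) := by
    rw [midpoint_eq_smul_add, invOf_eq_inv]; module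
  have e2 : (a - v) - (b - v) = a - b := by abel
  rw [e2] at h
  rw [e1, norm_smul, mul_pow, Real.norm_of_nonneg (by norm_num)]
  nlinarith

/-- The regularized objective has exactly one minimizer, and `argminOn` picks it. -/
theorem argmin_regObjective {D N : ℕ} (x : Fin N → Vec D) (y : Fin N → ℝ) {l : ℝ} (hl : 0 < l)
    (v w : Vec D) : IsArgmin (regObjective x y l v) Set.univ w ↔
      w = argminOn (regObjective x y l v) Set.univ := by
  have hex : ∃ w, IsArgmin (regObjective x y l v) Set.univ w := by
    have hc : Continuous (regObjective x y l v) := by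
      unfold regObjective; fun_prop
    have ht : Tendsto (regObjective x y l v) (cocompact (Vec D)) atTop := by
      have h1 : Tendsto (fun w : Vec D => l / 2 * (‖w‖ - ‖v‖) ^ 2) (cocompact (Vec D)) atTop := by
        refine Tendsto.const_mul_atTop (by positivity) ?_
        refine (tendsto_pow_atTop two_ne_zero).comp ?_
        exact tendsto_atTop_add_const_right _ _ tendsto_norm_cocompact_atTop
      refine tendsto_atTop_mono (fun w => ?_) h1
      have h2 : (‖w‖ - ‖v‖) ^ 2 ≤ ‖w - v‖ ^ 2 :=
        sq_le_sq' (by linarith [norm_sub_norm_le v w, norm_sub_rev v w]) (norm_sub_norm_le w v)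
      have h3 : 0 ≤ ∑ i, Real.exp (-(y i * inner ℝ w (x i))) :=
        Finset.sum_nonneg fun i _ => (Real.exp_pos _).le
      unfold regObjective
      nlinarith [mul_le_mul_of_nonneg_left h2 (by positivity : 0 ≤ l / 2)]
    obtain ⟨w, hw⟩ := hc.exists_forall_le ht
    exact ⟨w, Set.mem_univ _, fun z _ => hw z⟩
  have hspec : IsArgmin (regObjective x y l v) Set.univ
      (argminOn (regObjective x y l v) Set.univ) := Classical.epsilon_spec hex
  refine ⟨fun h => ?_, fun h => h ▸ hspec⟩
  set a := argminOn (regObjective x y l v) Set.univ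
  have h1 : regObjective x y l v w ≤ regObjective x y l v (midpoint ℝ w a) := h.2 (Set.mem_univ _)
  have h2 : regObjective x y l v a ≤ regObjective x y l v (midpoint ℝ w a) :=
    hspec.2 (Set.mem_univ _)
  have h3 : ∑ i, Real.exp (-(y i * inner ℝ (midpoint ℝ w a) (x i))) ≤
      (∑ i, Real.exp (-(y i * inner ℝ w (x i)))) / 2 +
        (∑ i, Real.exp (-(y i * inner ℝ a (x i)))) / 2 := by
    rw [Finset.sum_div, Finset.sum_div, ← Finset.sum_add_distrib]
    refine Finset.sum_le_sum fun i _ => ?_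
    have := convexOn_exp.2 (Set.mem_univ (-(y i * inner ℝ w (x i))))
      (Set.mem_univ (-(y i * inner ℝ a (x i)))) (by norm_num : (0 : ℝ) ≤ 1 / 2)
      (by norm_num : (0 : ℝ) ≤ 1 / 2) (by norm_num)
    rw [midpoint_eq_smul_add, invOf_eq_inv, inner_smul_left, inner_add_left]
    simp only [smul_eq_mul] at this
    convert this using 1
    · congr 1
      simp
      ring
    · ring
  unfold regObjective at h1 h2
  rw [sq_norm_midpoint] at h1 h2
  have h4 : l * ‖w - a‖ ^ 2 ≤ 0 := by nlinarith
  have h5 : ‖w - a‖ ^ 2 ≤ 0 := by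
    by_contra hcon
    push Not at hcon
    nlinarith [mul_pos hl hcon]
  have h6 : ‖w - a‖ = 0 := by nlinarith [norm_nonneg (w - a)]
  exact sub_eq_zero.mp (norm_eq_zero.mp h6)

/-- The projection onto the feasible set of a separable task exists and is unique. -/
theorem maxMarginProj_spec {D N : ℕ} (x : Fin N → Vec D) (y : Fin N → ℝ)
    (h : (feasibleSet x y).Nonempty) (v w : Vec D) :
    IsArgmin (fun w => ‖w - v‖ ^ 2) (feasibleSet x y) w ↔ w = maxMarginProj x y v := by
  have hclosed : IsClosed (feasibleSet x y) := by
    simp only [feasibleSet, Set.ofPred_forall]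
    exact isClosed_iInter fun i => isClosed_le continuous_const (by fun_prop)
  have hex : ∃ w, IsArgmin (fun w => ‖w - v‖ ^ 2) (feasibleSet x y) w := by
    obtain ⟨w, hw, hd⟩ := hclosed.exists_infDist_eq_dist h v
    refine ⟨w, hw, fun z hz => ?_⟩
    have := Metric.infDist_le_dist_of_mem (x := v) hz
    rw [hd, dist_comm v w, dist_comm v z, dist_eq_norm, dist_eq_norm] at this
    exact pow_le_pow_left₀ (norm_nonneg _) this 2
  have hspec : IsArgmin (fun w => ‖w - v‖ ^ 2) (feasibleSet x y) (maxMarginProj x y v) :=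
    Classical.epsilon_spec hex
  refine ⟨fun hw => ?_, fun hw => hw ▸ hspec⟩
  set a := maxMarginProj x y v
  have hm : midpoint ℝ w a ∈ feasibleSet x y := by
    intro i
    have hi := hw.1 i
    have hj := hspec.1 i
    rw [midpoint_eq_smul_add, invOf_eq_inv, inner_smul_left, inner_add_left]
    simp only [map_inv₀, map_ofNat]
    linarith
  have h1 : ‖w - v‖ ^ 2 ≤ ‖midpoint ℝ w a - v‖ ^ 2 := hw.2 hm
  have h2 : ‖a - v‖ ^ 2 ≤ ‖midpoint ℝ w a - v‖ ^ 2 := hspec.2 hm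
  rw [sq_norm_midpoint] at h1 h2
  have h6 : ‖w - a‖ = 0 := by nlinarith [norm_nonneg (w - a)]
  exact sub_eq_zero.mp (norm_eq_zero.mp h6)

/-! Write `λ_t = exp (-L)` and divide the iterate by `L`. Comparing the minimizer with `L • p`,
where `p` is the projection of the limiting centre, shows that the rescaled minimizer is almost as
close to its centre as `p` is, and that its margins are at least `1 - 3 log L / L`. Dividing by this
factor gives a feasible point of asymptotically minimal distance, and strong convexity of the
squared distance forces it to converge to `p` (`tendsto_argmin_regObjective`). Iterating
(`tendsto_regIterate`), the previous iterate measured on the new scale picks up the factor `log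
λ_{t-1} / log λ_t`, whose limit is `c_t`. Directions follow because the limits are nonzero.
Everything is pointwise in the samples. -/

/-! ### Geometry of the feasible set -/

theorem convex_feasibleSet {D N : ℕ} (x : Fin N → Vec D) (y : Fin N → ℝ) :
    Convex ℝ (feasibleSet x y) := by
  intro u hu v hv a b ha hb hab i
  have h1 := mul_le_mul_of_nonneg_left (hu i) ha
  have h2 := mul_le_mul_of_nonneg_left (hv i) hb
  rw [inner_add_left, real_inner_smul_left, real_inner_smul_left]
  linarith

theorem zero_notMem_feasibleSet {D N : ℕ} (hN : 0 < N) (x : Fin N → Vec D) (y : Fin N → ℝ) :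
    (0 : Vec D) ∉ feasibleSet x y := by
  intro h
  have := h ⟨0, hN⟩
  simp only [inner_zero_left, mul_zero] at this
  linarith

theorem maxMarginProj_isArgmin {D N : ℕ} {x : Fin N → Vec D} {y : Fin N → ℝ}
    (h : (feasibleSet x y).Nonempty) (v : Vec D) :
    IsArgmin (fun w => ‖w - v‖ ^ 2) (feasibleSet x y) (maxMarginProj x y v) :=
  (maxMarginProj_spec x y h v _).2 rfl

/-- A feasible point that is nearly as close to `v` as the projection of `v` is close to that
projection. -/
theorem sq_norm_sub_maxMarginProj_le {D N : ℕ} {x : Fin N → Vec D} {y : Fin N → ℝ}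
    {u : Vec D} (hu : u ∈ feasibleSet x y) (v : Vec D) :
    ‖u - maxMarginProj x y v‖ ^ 2 ≤ 2 * (‖u - v‖ ^ 2 - ‖maxMarginProj x y v - v‖ ^ 2) := by
  obtain ⟨hp, hmin⟩ := maxMarginProj_isArgmin ⟨u, hu⟩ v
  have hm := (convex_feasibleSet x y).midpoint_mem hu hp
  have h : ‖maxMarginProj x y v - v‖ ^ 2 ≤ ‖midpoint ℝ u (maxMarginProj x y v) - v‖ ^ 2 := hmin hm
  rw [sq_norm_midpoint] at h
  linarith

/-! ### Asymptotics of one regularized step -/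

/-- Comparison of the minimizer of the regularized objective with a rescaled feasible point. -/
theorem regObjective_argmin_le {D N : ℕ} {x : Fin N → Vec D} {y : Fin N → ℝ} {p : Vec D}
    (hp : p ∈ feasibleSet x y) {L : ℝ} (hL : 0 < L) (v : Vec D) :
    regObjective x y (Real.exp (-L)) (L • v)
        (argminOn (regObjective x y (Real.exp (-L)) (L • v)) Set.univ) ≤
      Real.exp (-L) * (N + L ^ 2 / 2 * ‖p - v‖ ^ 2) := by
  -- At `L • p` every margin is at least `L`, so each loss term is at most the regularization
  -- strength `exp (-L)`.
  refine (((argmin_regObjective x y (Real.exp_pos _) (L • v) _).2 rfl).2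
    (Set.mem_univ (L • p))).trans ?_
  have hsum : ∑ i, Real.exp (-(y i * inner ℝ (L • p) (x i))) ≤ N * Real.exp (-L) := by
    refine (Finset.sum_le_card_nsmul Finset.univ _ (Real.exp (-L)) fun i _ => ?_).trans_eq
      (by simp)
    rw [Real.exp_le_exp, real_inner_smul_left]
    nlinarith [mul_le_mul_of_nonneg_left (hp i) hL.le]
  rw [regObjective, ← smul_sub, norm_smul, Real.norm_of_nonneg hL.le]
  nlinarith

/-- Drop the nonnegative loss from the comparison and divide by `exp (-L) * L ^ 2 / 2`. -/
theorem sq_norm_argmin_regObjective_sub_le {D N : ℕ} {x : Fin N → Vec D} {y : Fin N → ℝ}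
    {p : Vec D} (hp : p ∈ feasibleSet x y) {L : ℝ} (hL : 0 < L) (v : Vec D) :
    ‖L⁻¹ • argminOn (regObjective x y (Real.exp (-L)) (L • v)) Set.univ - v‖ ^ 2 ≤
      2 * N / L ^ 2 + ‖p - v‖ ^ 2 := by
  have h := regObjective_argmin_le hp hL v
  set w := argminOn (regObjective x y (Real.exp (-L)) (L • v)) Set.univ
  have h0 : 0 ≤ ∑ i, Real.exp (-(y i * inner ℝ w (x i))) :=
    Finset.sum_nonneg fun i _ => (Real.exp_pos _).le
  have hw : w - L • v = L • (L⁻¹ • w - v) := by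
    rw [smul_sub, smul_inv_smul₀ hL.ne']
  rw [regObjective, hw, norm_smul, Real.norm_of_nonneg hL.le] at h
  have h1 : L ^ 2 / 2 * ‖L⁻¹ • w - v‖ ^ 2 ≤ N + L ^ 2 / 2 * ‖p - v‖ ^ 2 := by
    refine le_of_mul_le_mul_left ?_ (Real.exp_pos (-L))
    nlinarith
  have h2 : 2 * N / L ^ 2 + ‖p - v‖ ^ 2 = (N + L ^ 2 / 2 * ‖p - v‖ ^ 2) / (L ^ 2 / 2) := by
    field_simp
  rw [h2, le_div_iff₀ (by positivity)]
  linarith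

/-- Drop the quadratic term instead: each single exponential is at most `exp (-L) * L ^ 3`; take
logarithms. The cube dominates the quadratic bound for large `L` and costs only `3 log L`. -/
theorem le_margin_argmin_regObjective {D N : ℕ} {x : Fin N → Vec D} {y : Fin N → ℝ}
    {p : Vec D} (hp : p ∈ feasibleSet x y) {L : ℝ} (hL : 0 < L) {v : Vec D}
    (hlarge : N + L ^ 2 / 2 * ‖p - v‖ ^ 2 ≤ L ^ 3) (i : Fin N) :
    1 - 3 * (Real.log L / L) ≤ y i * inner ℝ
      (L⁻¹ • argminOn (regObjective x y (Real.exp (-L)) (L • v)) Set.univ) (x i) := by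
  have h := (regObjective_argmin_le hp hL v).trans
    (mul_le_mul_of_nonneg_left hlarge (Real.exp_pos _).le)
  set w := argminOn (regObjective x y (Real.exp (-L)) (L • v)) Set.univ
  have h1 : Real.exp (-(y i * inner ℝ w (x i))) ≤ Real.exp (-L) * L ^ 3 := by
    have h2 := Finset.single_le_sum (f := fun i => Real.exp (-(y i * inner ℝ w (x i))))
      (fun i _ => (Real.exp_pos _).le) (Finset.mem_univ i)
    have h3 : 0 ≤ Real.exp (-L) / 2 * ‖w - L • v‖ ^ 2 := by positivity
    rw [regObjective] at h
    exact h2.trans (by linarith)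
  have h4 := Real.log_le_log (Real.exp_pos _) h1
  rw [Real.log_exp, Real.log_mul (Real.exp_pos _).ne' (by positivity), Real.log_exp,
    Real.log_pow] at h4
  push_cast at h4
  rw [real_inner_smul_left]
  have h5 : 1 - 3 * (Real.log L / L) = L⁻¹ * (L - 3 * Real.log L) := by field_simp
  rw [h5, mul_left_comm]
  exact mul_le_mul_of_nonneg_left (by linarith) (inv_nonneg.2 hL.le)

/-- One regularized step with strength `exp (-L)`, rescaled by `L`, converges to the projection
onto the feasible set as `L → ∞`. -/
theorem tendsto_argmin_regObjective {ι : Type*} {F : Filter ι} {D N : ℕ} {x : Fin N → Vec D}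
    {y : Fin N → ℝ} (h : (feasibleSet x y).Nonempty) {L : ι → ℝ} (hL : Tendsto L F atTop)
    {v : ι → Vec D} {v₀ : Vec D} (hv : Tendsto v F (𝓝 v₀)) :
    Tendsto (fun j => (L j)⁻¹ •
        argminOn (regObjective x y (Real.exp (-L j)) (L j • v j)) Set.univ) F
      (𝓝 (maxMarginProj x y v₀)) := by
  set p := maxMarginProj x y v₀ with hp_def
  have hp : p ∈ feasibleSet x y := (maxMarginProj_isArgmin h v₀).1
  set u : ι → Vec D := fun j => (L j)⁻¹ •
    argminOn (regObjective x y (Real.exp (-L j)) (L j • v j)) Set.univ with hu_def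
  set s : ι → ℝ := fun j => 1 - 3 * (Real.log (L j) / L j)
  set b : ι → ℝ := fun j => √(2 * N / L j ^ 2 + ‖p - v j‖ ^ 2)
  have hs : Tendsto s F (𝓝 1) := by
    have h1 : Tendsto (fun z : ℝ => Real.log z / z) atTop (𝓝 0) :=
      Real.isLittleO_log_id_atTop.tendsto_div_nhds_zero
    simpa using ((h1.comp hL).const_mul 3).const_sub 1
  have hpv : Tendsto (fun j => ‖p - v j‖) F (𝓝 ‖p - v₀‖) := (hv.const_sub p).norm
  have hb : Tendsto b F (𝓝 ‖p - v₀‖) := by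
    have h1 : Tendsto (fun j => 2 * N / L j ^ 2) F (𝓝 0) :=
      ((tendsto_pow_atTop two_ne_zero).comp hL).const_div_atTop _
    have h2 := (h1.add (hpv.pow 2)).sqrt
    rwa [zero_add, Real.sqrt_sq (norm_nonneg _)] at h2
  have hLpos : ∀ᶠ j in F, 0 < L j := hL.eventually_gt_atTop 0
  have hspos : ∀ᶠ j in F, 0 < s j := hs.eventually_const_lt one_pos
  have hlarge : ∀ᶠ j in F, N + L j ^ 2 / 2 * ‖p - v j‖ ^ 2 ≤ L j ^ 3 := by
    filter_upwards [(hpv.pow 2).eventually_le_const (lt_add_one _), hL.eventually_ge_atTop 1,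
      hL.eventually_ge_atTop (N + (‖p - v₀‖ ^ 2 + 1))] with j h1 h2 h3
    have h4 : 1 ≤ L j ^ 2 := one_le_pow₀ h2
    have hN : (0 : ℝ) ≤ N := N.cast_nonneg
    have h5 := mul_le_mul_of_nonneg_left h3 (zero_le_one.trans h4)
    have h6 := mul_le_mul_of_nonneg_left h1 (zero_le_one.trans h4)
    have h7 : 0 ≤ L j ^ 2 * ‖p - v j‖ ^ 2 := by positivity
    nlinarith
  have hub : ∀ᶠ j in F, ‖u j - v j‖ ≤ b j := by
    filter_upwards [hLpos] with j hj
    exact Real.le_sqrt_of_sq_le (sq_norm_argmin_regObjective_sub_le hp hj (v j))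
  -- Since `s j` bounds all margins of `u j` from below, dividing by it restores exact feasibility.
  have hfeas : ∀ᶠ j in F, (s j)⁻¹ • u j ∈ feasibleSet x y := by
    filter_upwards [hLpos, hspos, hlarge] with j h1 h2 h3 i
    rw [real_inner_smul_left, mul_left_comm, ← div_eq_inv_mul, le_div_iff₀ h2, one_mul]
    exact le_margin_argmin_regObjective hp h1 h3 i
  have hdist : ∀ᶠ j in F, ‖(s j)⁻¹ • u j - v₀‖ ≤
      |(s j)⁻¹ - 1| * (b j + ‖v j‖) + b j + ‖v j - v₀‖ := by
    filter_upwards [hub] with j hj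
    have e : (s j)⁻¹ • u j - v₀ = ((s j)⁻¹ - 1) • u j + (u j - v j) + (v j - v₀) := by
      module
    have h1 : ‖u j‖ ≤ b j + ‖v j‖ := by
      linarith [norm_sub_norm_le (u j) (v j)]
    have h2 : ‖((s j)⁻¹ - 1) • u j‖ ≤ |(s j)⁻¹ - 1| * (b j + ‖v j‖) := by
      rw [norm_smul, Real.norm_eq_abs]
      exact mul_le_mul_of_nonneg_left h1 (abs_nonneg _)
    rw [e]
    exact norm_add₃_le.trans (by linarith)
  have hB : Tendsto (fun j => |(s j)⁻¹ - 1| * (b j + ‖v j‖) + b j + ‖v j - v₀‖) F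
      (𝓝 ‖p - v₀‖) := by
    have h1 := ((hs.inv₀ one_ne_zero).sub_const 1).abs
    have h2 := ((h1.mul (hb.add hv.norm)).add hb).add (hv.sub_const v₀).norm
    simpa using h2
  -- Only the upper bound on the distance to `v₀` is needed: near-optimal feasible points are close
  -- to `p`.
  have hsq : Tendsto (fun j => ‖(s j)⁻¹ • u j - p‖ ^ 2) F (𝓝 0) := by
    have h1 := ((hB.pow 2).sub_const (‖p - v₀‖ ^ 2)).const_mul 2
    rw [sub_self, mul_zero] at h1
    refine tendsto_of_tendsto_of_tendsto_of_le_of_le' tendsto_const_nhds h1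
      (Eventually.of_forall fun j => by positivity) ?_
    filter_upwards [hfeas, hdist] with j h2 h3
    refine (sq_norm_sub_maxMarginProj_le h2 v₀).trans ?_
    have h4 := pow_le_pow_left₀ (norm_nonneg _) h3 2
    rw [← hp_def]
    linarith
  have hlim : Tendsto (fun j => (s j)⁻¹ • u j) F (𝓝 p) := by
    rw [tendsto_iff_norm_sub_tendsto_zero]
    have h1 := hsq.sqrt
    simpa only [Real.sqrt_sq (norm_nonneg _), Real.sqrt_zero] using h1
  have h1 := hs.smul hlim
  rw [one_smul] at h1
  refine h1.congr' ?_
  filter_upwards [hspos] with j hj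
  exact smul_inv_smul₀ hj.ne' _

/-! ### Induction over iterations and passage to directions -/

/-- The iterates of regularized continual learning, divided by `log (1 / λ_t)`, converge to those
of the scheduled Sequential Max-Margin scheme. -/
theorem tendsto_regIterate {D T : ℕ} {n : Fin T → ℕ} {x : (m : Fin T) → Fin (n m) → Vec D}
    {y : (m : Fin T) → Fin (n m) → ℝ} (hsep : ∀ m, (feasibleSet (x m) (y m)).Nonempty)
    {k : ℕ} (τ : ℕ → Fin T) {lam : ℕ → ℝ → ℝ} {c : ℕ → ℝ}
    (hpos : ∀ t, 1 ≤ t → t ≤ k → ∀ l : ℝ, 0 < l → 0 < lam t l)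
    (hL : ∀ t, 1 ≤ t → t ≤ k → Tendsto (fun l => -Real.log (lam t l)) (𝓝[>] 0) atTop)
    (hc : ∀ t, 2 ≤ t → t ≤ k →
      Tendsto (fun l => Real.log (lam (t - 1) l) / Real.log (lam t l)) (𝓝[>] 0) (𝓝 (c t)))
    (t : ℕ) (ht : 1 ≤ t) (htk : t ≤ k) :
    Tendsto (fun l => (-Real.log (lam t l))⁻¹ • regIterate x y τ (fun s => lam s l) t) (𝓝[>] 0)
      (𝓝 (smmIterate x y τ c t)) := by
  induction t, ht using Nat.le_induction with
  | base =>
    have h := tendsto_argmin_regObjective (hsep (τ 1)) (hL 1 le_rfl htk)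
      (tendsto_const_nhds (x := (0 : Vec D)))
    simp only [smmIterate, regIterate, smul_zero] at h ⊢
    refine h.congr' ?_
    filter_upwards [self_mem_nhdsWithin] with l hl
    rw [neg_neg, Real.exp_log (hpos 1 le_rfl htk l hl)]
  | succ t ht ih =>
    -- Change of scale: the old logarithm cancels in the product of the ratio with the rescaled
    -- previous iterate.
    have hprev := (hc (t + 1) (by omega) htk).smul (ih (by omega))
    have hv : Tendsto (fun l => (-Real.log (lam (t + 1) l))⁻¹ •
        regIterate x y τ (fun s => lam s l) t) (𝓝[>] 0)
        (𝓝 (c (t + 1) • smmIterate x y τ c t)) := by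
      refine hprev.congr' ?_
      filter_upwards [(hL t ht (by omega)).eventually_gt_atTop 0] with l hl
      rw [smul_smul, Nat.add_sub_cancel]
      have : Real.log (lam t l) ≠ 0 := (neg_pos.1 hl).ne
      congr 1
      field_simp
    refine (tendsto_argmin_regObjective (hsep (τ (t + 1))) (hL (t + 1) (by omega) htk) hv).congr' ?_
    filter_upwards [(hL (t + 1) (by omega) htk).eventually_gt_atTop 0, self_mem_nhdsWithin]
      with l h1 h2
    rw [smul_inv_smul₀ h1.ne', neg_neg, Real.exp_log (hpos (t + 1) (by omega) htk l h2)]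
    rfl

theorem smmIterate_ne_zero {D T : ℕ} {n : Fin T → ℕ} (hn : ∀ m, 0 < n m)
    {x : (m : Fin T) → Fin (n m) → Vec D} {y : (m : Fin T) → Fin (n m) → ℝ}
    (hsep : ∀ m, (feasibleSet (x m) (y m)).Nonempty) (τ : ℕ → Fin T) (c : ℕ → ℝ)
    {t : ℕ} (ht : t ≠ 0) : smmIterate x y τ c t ≠ 0 := by
  obtain ⟨t, rfl⟩ := Nat.exists_eq_succ_of_ne_zero ht
  intro h0
  have h := (maxMarginProj_isArgmin (hsep (τ (t + 1))) (c (t + 1) • smmIterate x y τ c t)).1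
  rw [smmIterate] at h0
  rw [h0] at h
  exact zero_notMem_feasibleSet (hn _) _ _ h

theorem theorem5 {D T : ℕ} (n : Fin T → ℕ) (hn : ∀ m, 0 < n m)
    (μ : Measure ((m : Fin T) → Fin (n m) → Vec D)) (hμ : μ ≪ volume) :
    ∀ᵐ x ∂μ, ∀ y : (m : Fin T) → Fin (n m) → ℝ,
      (∀ m i, y m i = 1 ∨ y m i = -1) →
      (∀ m, (feasibleSet (x m) (y m)).Nonempty) →
      ∀ (k : ℕ) (τ : ℕ → Fin T) (lam : ℕ → ℝ → ℝ) (c : ℕ → ℝ),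
        (∀ t, 1 ≤ t → t ≤ k → ∀ l : ℝ, 0 < l → 0 < lam t l) →
        (∀ t, 1 ≤ t → t ≤ k → Tendsto (lam t) (𝓝[>] 0) (𝓝 0)) →
        (∀ t, 2 ≤ t → t ≤ k →
          Tendsto (fun l => Real.log (lam (t - 1) l) / Real.log (lam t l)) (𝓝[>] 0)
            (𝓝 (c t))) →
        ∀ t, 1 ≤ t → t ≤ k →
          smmIterate x y τ c t ≠ 0 ∧
          Tendsto
            (fun l => ‖regIterate x y τ (fun s => lam s l) t‖⁻¹ •
              regIterate x y τ (fun s => lam s l) t)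
            (𝓝[>] 0)
            (𝓝 (‖smmIterate x y τ c t‖⁻¹ • smmIterate x y τ c t)) := by
  refine Eventually.of_forall fun x y _ hsep k τ lam c hpos hlam hc t ht htk => ?_
  have hne := smmIterate_ne_zero hn hsep τ c (Nat.one_le_iff_ne_zero.1 ht)
  have hL : ∀ t, 1 ≤ t → t ≤ k →
      Tendsto (fun l => -Real.log (lam t l)) (𝓝[>] 0) atTop := by
    intro t ht htk
    refine tendsto_neg_atBot_atTop.comp (Real.tendsto_log_nhdsGT_zero.comp ?_)
    refine tendsto_nhdsWithin_iff.2 ⟨hlam t ht htk, ?_⟩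
    filter_upwards [self_mem_nhdsWithin] with l hl
    exact hpos t ht htk l hl
  have hlim := tendsto_regIterate hsep τ hpos hL hc t ht htk
  -- Normalization is continuous at the nonzero limit and eliminates the positive scale.
  refine ⟨hne, ((hlim.norm.inv₀ (norm_ne_zero_iff.2 hne)).smul hlim).congr' ?_⟩
  filter_upwards [(hL t ht htk).eventually_gt_atTop 0] with l hl
  rw [norm_smul, norm_inv, Real.norm_of_nonneg hl.le, smul_smul]
  rw [mul_inv, inv_inv, mul_right_comm, mul_inv_cancel₀ hl.ne', one_mul]
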